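/- Let $n\ge 1$, and for each site $k\in\{1,\dots,n\}$ let $d_k$ be a physical dimension, $\sigma_k\in\mathbb R$, and $\phi_k$ a feature map from the $k$-th input space to $\mathbb R^{d_k}$. For bond dimensions $\alpha=(\alpha_1,\dots,\alpha_n)$, $\alpha_k\ge 1$, with the cyclic convention $\alpha_{n+1}=\alpha_1$, a matrix product state (MPS) has tensors $A^{(k)}=(A^{(k),s}_{ab})$ with $1\le s\le d_k$, $1\le a\le\alpha_k$, $1\le b\le\alpha_{k+1}$, and its output on $\mathbf x=(x_1,\dots,x_n)$ is $$\Psi(\mathbf x;\mathbf A)=\sum_{s_1,\dots,s_n}\ \sum_{a_1,\dots,a_n}A^{(1),s_1}_{a_1a_2}A^{(2),s_2}_{a_2a_3}\cdots A^{(n),s_n}_{a_na_1}\prod_{k=1}^n\phi_k^{s_k}(x_k).$$ Its neural tangent kernel (NTK) is $$K(\mathbf x,\mathbf y)=\sum_{k=1}^n\eta_k\sum_{s,a,b}\frac{\partial\Psi(\mathbf x)}{\partial A^{(k),s}_{ab}}\,\frac{\partial\Psi(\mathbf y)}{\partial A^{(k),s}_{ab}},\qquad \eta_k=(\alpha_k\alpha_{k+1})^{-1/2}.$$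 For every $\alpha$, let the tensors be initialized with independent entries $A^{(k),s}_{ab}\sim\mathcal N\!\big(0,\ \sigma_k^2/\sqrt{\alpha_k\alpha_{k+1}}\big)$. Let $\mathbf x^{(1)},\dots,\mathbf x^{(m)}$ be fixed inputs. Then, as the bond dimensions go to infinity sequentially, one after another, in any order $\alpha_{\pi(1)},\dots,\alpha_{\pi(n)}$, the random $m\times m$ matrix $\big(K(\mathbf x^{(i)},\mathbf x^{(j)})\big)_{i,j}$ at initialization converges in probability to the deterministic matrix $K_\infty$ with the entries $$K_\infty(\mathbf x^{(i)},\mathbf x^{(j)})=\sum_{k=1}^n\phi_k(x^{(i)}_k)\cdot\phi_k(x^{(j)}_k)\prod_{l\ne k}\sigma_l^2\,\phi_l(x^{(i)}_l)\cdot\phi_l(x^{(j)}_l).$$ Here sequential convergence in probability means that for all $\varepsilon,\delta>0$, for all sufficiently large $\alpha_{\pi(n)}$, for all sufficiently large $\alpha_{\pi(n-1)}$ (depending on $\alpha_{\pi(n)}$), and so on down to all sufficiently large $\alpha_{\pi(1)}$ (depending on all the others), one has $\mathbb P\big(\max_{i,j}|K(\mathbf x^{(i)},\mathbf x^{(j)})-K_\infty(\mathbf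 x^{(i)},\mathbf x^{(j)})|\ge\varepsilon\big)\le\delta$. -/

import Mathlib

open MeasureTheory ProbabilityTheory Filter Topology

noncomputable section

namespace MPS

/-- The scalar parameters of a periodic matrix product state with `n` sites, physical dimensions
`d k` and bond dimensions `α k`: the tensor at site `k` has the entries `A^s_{a b}` with
`s < d k`, `a < α k`, `b < α (k + 1)`. Addition in `Fin n` is cyclic, so that the last tensor
carries the bond indices `(α_n, α_1)`. -/
abbrev Param {n : ℕ} [NeZero n] (d : Fin n → ℕ) (α : Fin n → ℕ+) : Type :=
  (k : Fin n) × (Fin (d k) × Fin (α k : ℕ) × Fin (α (k + 1) : ℕ))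

/-- The output
`Ψ(x; A) = ∑_{s, a} A^{s_1}_{a_1 a_2} ⋯ A^{s_n}_{a_n a_1} φ^{s_1}(x_1) ⋯ φ^{s_n}(x_n)`. -/
def output {n : ℕ} [NeZero n] {d : Fin n → ℕ} {X : Fin n → Type*}
    (φ : (k : Fin n) → X k → Fin (d k) → ℝ) (α : Fin n → ℕ+)
    (A : Param d α → ℝ) (x : (k : Fin n) → X k) : ℝ :=
  ∑ s : ((k : Fin n) → Fin (d k)), ∑ a : ((k : Fin n) → Fin (α k : ℕ)),
    (∏ k, A ⟨k, s k, a k, a (k + 1)⟩) * ∏ k, φ k (x k) (s k)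

/-- The partial derivative of `Ψ(x; ·)` at `A` with respect to the entry `p`. -/
def partialOutput {n : ℕ} [NeZero n] {d : Fin n → ℕ} {X : Fin n → Type*}
    (φ : (k : Fin n) → X k → Fin (d k) → ℝ) (α : Fin n → ℕ+)
    (A : Param d α → ℝ) (x : (k : Fin n) → X k) (p : Param d α) : ℝ :=
  deriv (fun t : ℝ => output φ α (Function.update A p t) x) (A p)

/-- The learning rate `(α_k α_{k+1})^{-1/2}` of the entries of the tensor at site `k`. -/
def learningRate {n : ℕ} [NeZero n] (α : Fin n → ℕ+) (k : Fin n) : ℝ :=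
  ((α k : ℝ) * (α (k + 1) : ℝ)) ^ (-(1 / 2) : ℝ)

/-- The neural tangent kernel
`K(x, y) = ∑_p η_p (∂Ψ(x)/∂A_p) (∂Ψ(y)/∂A_p)`, the sum running over all scalar parameters. -/
def ntk {n : ℕ} [NeZero n] {d : Fin n → ℕ} {X : Fin n → Type*}
    (φ : (k : Fin n) → X k → Fin (d k) → ℝ) (α : Fin n → ℕ+)
    (A : Param d α → ℝ) (x y : (k : Fin n) → X k) : ℝ :=
  ∑ p : Param d α, learningRate α p.1 * (partialOutput φ α A x p * partialOutput φ α A y p)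

/-- The deterministic kernel
`∑_k φ(x_k)·φ(y_k) ∏_{l ≠ k} σ_l² φ(x_l)·φ(y_l)`. -/
def limitKernel {n : ℕ} {d : Fin n → ℕ} {X : Fin n → Type*}
    (φ : (k : Fin n) → X k → Fin (d k) → ℝ) (σ : Fin n → ℝ)
    (x y : (k : Fin n) → X k) : ℝ :=
  ∑ k, (φ k (x k) ⬝ᵥ φ k (y k)) *
    ∏ l ∈ Finset.univ.erase k, σ l ^ 2 * (φ l (x l) ⬝ᵥ φ l (y l))

/-- The variance `σ_k² / √(α_k α_{k+1})` of the entries of the tensor at site `k`. -/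
def initVariance {n : ℕ} [NeZero n] (σ : Fin n → ℝ) (α : Fin n → ℕ+) (k : Fin n) : NNReal :=
  ⟨σ k ^ 2 / √((α k : ℝ) * (α (k + 1) : ℝ)), by positivity⟩

/-- The random parameters `A` are initialized at bond dimensions `α`: all entries are independent,
and those of the tensor at site `k` are centred Gaussian with variance
`σ_k² / √(α_k α_{k+1})`. -/
structure IsGaussianInit {n : ℕ} [NeZero n] {d : Fin n → ℕ} {Ω : Type*} [MeasurableSpace Ω]
    (μ : Measure Ω) (σ : Fin n → ℝ) (α : Fin n → ℕ+) (A : Ω → Param d α → ℝ) : Prop where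
  indep : iIndepFun (fun (p : Param d α) (ω : Ω) => A ω p) μ
  law : ∀ p : Param d α, HasLaw (fun ω => A ω p) (gaussianReal 0 (initVariance σ α p.1)) μ

/-- The filter of an iterated limit in some of the coordinates, the others being kept as in `α`.
The list gives the coordinates from the outermost (last) limit to the innermost (first) one:
`P` holds eventually along `iteratedAtTop [k_r, …, k_1] α` if and only if
`∀ᶠ N_r, …, ∀ᶠ N_1`, `P` holds at `α` with the coordinates `k_j` replaced by `N_j`. -/
def iteratedAtTop {n : ℕ} : List (Fin n) → (Fin n → ℕ+) → Filter (Fin n → ℕ+)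
  | [], α => pure α
  | k :: ks, α =>
      Filter.bind (atTop : Filter ℕ+) fun N => iteratedAtTop ks (Function.update α k N)

/-- The filter on bond dimensions which go to infinity one after another, in the order
`π 0, π 1, …, π (n - 1)`: the limit in coordinate `π 0` is taken first, with all the others
fixed, and the one in coordinate `π (n - 1)` last. All coordinates occur, so that the starting
value `1` plays no role. -/
def sequentialAtTop {n : ℕ} (π : Equiv.Perm (Fin n)) : Filter (Fin n → ℕ+) :=
  iteratedAtTop (List.ofFn π).reverse 1

end MPS

end

/-! The output is affine in each single tensor entry, so its partial derivatives are feature values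
times open chains, and the NTK is a sum over sites `k` of `φ_k·φ_k` times a normalized `overlap`
(the inner product of the open chains of `x` and `y` at `k`). The proof is a second-moment
computation for each of these overlaps.

Distinct sites are independent, so expectations factor over sites and Isserlis' theorem evaluates
each factor. For the mean there is only one pairing, every bond sum gives `α_l`, and this cancels
the normalization exactly: the mean equals its limit at every finite `α` (`integral_overlap`).

For the second moment each site carries one of three pairings of its four indices. A bond between
sites with equal pairings contributes `α_l ^ 2`, otherwise `α_l`, so after normalization every
mismatch costs `α_l⁻¹` (`integral_overlap_sq`). In the limit only constant assignments survive. The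
removed site `k` forces pairing `0`, whose weight is the square of the mean. Hence the variance
vanishes, and Chebyshev's inequality concludes. Only the divergence of every bond dimension is used,
so the order of the limits is irrelevant. -/

noncomputable section

namespace MPS

/-! ### Fourth moments of Gaussian variables. -/

section GaussianMoments

/-- The fourth moment of a centred Gaussian measure. -/
theorem integral_pow_four_gaussianReal (v : NNReal) :
    ∫ x, x ^ 4 ∂(gaussianReal 0 v) = 3 * (v : ℝ) ^ 2 := by
  have h1 : ∫ x, x ^ 4 ∂(gaussianReal 0 v)
      = iteratedDeriv 4 (mgf (fun x ↦ x) (gaussianReal 0 v)) 0 := by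
    rw [iteratedDeriv_mgf_zero] <;> simp
  rw [h1, mgf_fun_id_gaussianReal]
  have hE (t : ℝ) : HasDerivAt (fun t : ℝ => Real.exp (0 * t + v * t ^ 2 / 2))
      (Real.exp (0 * t + v * t ^ 2 / 2) * (v * t)) t := by
    convert! (((hasDerivAt_id t).const_mul (0 : ℝ)).add
      ((((hasDerivAt_id t).pow 2).const_mul (v : ℝ)).div_const 2)).exp using 1
    simp; ring
  -- On multiples of the Gaussian exponential, differentiation acts on the polynomial factor by `q ↦
  -- v t q + q'`; the fourth derivative at `0` is then read off.
  have hmul (q q' : ℝ → ℝ) (hq : ∀ t, HasDerivAt q (q' t) t) :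
      deriv (fun t => Real.exp (0 * t + v * t ^ 2 / 2) * q t)
        = fun t => Real.exp (0 * t + v * t ^ 2 / 2) * (v * t * q t + q' t) := by
    funext t
    refine ((hE t).mul (hq t)).deriv.trans ?_
    ring
  have d1 : deriv (fun t : ℝ => Real.exp (0 * t + v * t ^ 2 / 2))
      = fun t => Real.exp (0 * t + v * t ^ 2 / 2) * (v * t) := funext fun t => (hE t).deriv
  rw [iteratedDeriv_eq_iterate]
  simp only [Function.iterate_succ, Function.comp, Function.iterate_zero, id]
  rw [d1, hmul (fun t => v * t) (fun _ => v) (fun t => by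
      simpa using (hasDerivAt_id t).const_mul (v : ℝ)),
    hmul (fun t => v * t * (v * t) + v) (fun t => 2 * v ^ 2 * t) (fun t => by
      convert! (((hasDerivAt_id t).const_mul (v : ℝ)).mul
        ((hasDerivAt_id t).const_mul (v : ℝ))).add_const (v : ℝ) using 1
      simp; ring),
    hmul (fun t => v * t * (v * t * (v * t) + v) + 2 * v ^ 2 * t)
      (fun t => 3 * v ^ 3 * t ^ 2 + 3 * v ^ 2) (fun t => by
      have : (fun t : ℝ => v * t * (v * t * (v * t) + v) + 2 * v ^ 2 * t)
        = fun t : ℝ => v ^ 3 * t ^ 3 + 3 * v ^ 2 * t := by funext t; ring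
      rw [this]
      convert! ((((hasDerivAt_id t).pow 3).const_mul ((v : ℝ) ^ 3)).add
        ((hasDerivAt_id t).const_mul (3 * (v : ℝ) ^ 2))) using 1
      simp; ring)]
  simp

variable {Ω : Type*} {mΩ : MeasurableSpace Ω} {P : Measure Ω}

theorem HasGaussianLaw.integral_pow_four {X : Ω → ℝ} (h : HasGaussianLaw X P)
    (h0 : ∫ ω, X ω ∂P = 0) : ∫ ω, X ω ^ 4 ∂P = 3 * (∫ ω, X ω ^ 2 ∂P) ^ 2 := by
  have hm := h.map_eq_gaussianReal
  have hP := h.isProbabilityMeasure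
  have hvar : Var[X; P] = ∫ ω, X ω ^ 2 ∂P := by
    rw [variance_eq_integral h.aemeasurable, h0]; simp
  rw [h0, hvar] at hm
  have : ∫ ω, X ω ^ 4 ∂P = ∫ x, x ^ 4 ∂(P.map X) := by
    rw [integral_map h.aemeasurable (by fun_prop)]
  rw [this, hm, integral_pow_four_gaussianReal, Real.coe_toNNReal _ (by positivity)]

/-- **Isserlis' theorem** for four jointly Gaussian centred variables. -/
theorem HasGaussianLaw.integral_prod_four {X : Fin 4 → Ω → ℝ}
    (h : HasGaussianLaw (fun ω i => X i ω) P) (h0 : ∀ i, ∫ ω, X i ω ∂P = 0) :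
    ∫ ω, X 0 ω * X 1 ω * X 2 ω * X 3 ω ∂P =
      (∫ ω, X 0 ω * X 1 ω ∂P) * (∫ ω, X 2 ω * X 3 ω ∂P) +
      (∫ ω, X 0 ω * X 2 ω ∂P) * (∫ ω, X 1 ω * X 3 ω ∂P) +
      (∫ ω, X 0 ω * X 3 ω ∂P) * (∫ ω, X 1 ω * X 2 ω ∂P) := by
  have hX (i : Fin 4) : HasGaussianLaw (X i) P := h.eval i
  have hmul (i j : Fin 4) : Integrable (fun ω => X i ω * X j ω) P :=
    (hX i).memLp_two.integrable_mul (hX j).memLp_two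
  have hL (c : Fin 4 → ℝ) : HasGaussianLaw (fun ω => ∑ i, c i * X i ω) P := by
    have := h.map_fun (∑ i, c i • ContinuousLinearMap.proj (R := ℝ) (φ := fun _ : Fin 4 => ℝ) i)
    simpa using this
  have hL0 (c : Fin 4 → ℝ) : ∫ ω, ∑ i, c i * X i ω ∂P = 0 := by
    rw [integral_finsetSum _ fun i _ => (hX i).integrable.const_mul _]
    simp [integral_const_mul, h0]
  have hL2 (c : Fin 4 → ℝ) : ∫ ω, (∑ i, c i * X i ω) ^ 2 ∂P
      = ∑ i, ∑ j, c i * c j * ∫ ω, X i ω * X j ω ∂P := by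
    have : ∀ ω, (∑ i, c i * X i ω) ^ 2 = ∑ i, ∑ j, c i * c j * (X i ω * X j ω) := by
      intro ω
      rw [sq, Finset.sum_mul_sum]
      exact Finset.sum_congr rfl fun i _ => Finset.sum_congr rfl fun j _ => by ring
    simp_rw [this]
    rw [integral_finsetSum _ fun i _ => integrable_finsetSum _ fun j _ => (hmul i j).const_mul _]
    refine Finset.sum_congr rfl fun i _ => ?_
    rw [integral_finsetSum _ fun j _ => (hmul i j).const_mul _]
    exact Finset.sum_congr rfl fun j _ => integral_const_mul _ _
  have hL4 (c : Fin 4 → ℝ) : Integrable (fun ω => (∑ i, c i * X i ω) ^ 4) P :=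
    ((hL c).memLp (p := 4) (by simp)).integrable_norm_pow (by simp) |>.congr
      (ae_of_all _ fun ω => by simp [Even.pow_abs (by decide : Even 4)])
  have hI (c : Fin 4 → ℝ) := HasGaussianLaw.integral_pow_four (hL c) (hL0 c)
  have hsymm (i j : Fin 4) : ∫ ω, X i ω * X j ω ∂P = ∫ ω, X j ω * X i ω ∂P := by
    simp_rw [mul_comm]
  -- Polarization: averaging against the three signs kills every monomial not odd in `X 1`, `X 2`,
  -- `X 3`, and degree four leaves only the full product. Its coefficient is `4! * 2 ^ 3 = 192`.
  -- This reduces Isserlis to fourth moments of linear forms.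
  have key : ∀ ω, X 0 ω * X 1 ω * X 2 ω * X 3 ω = 192⁻¹ * ∑ ε : Fin 2 × Fin 2 × Fin 2,
      ((-1) ^ (ε.1 : ℕ) * (-1) ^ (ε.2.1 : ℕ) * (-1) ^ (ε.2.2 : ℕ)) *
      (∑ i, (![1, (-1) ^ (ε.1 : ℕ), (-1) ^ (ε.2.1 : ℕ), (-1) ^ (ε.2.2 : ℕ)] : Fin 4 → ℝ) i
        * X i ω) ^ 4 := by
    intro ω
    simp [Fintype.sum_prod_type, Fin.sum_univ_succ]
    ring
  simp_rw [key]
  rw [integral_const_mul, integral_finsetSum _ fun ε _ => (hL4 _).const_mul _]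
  simp_rw [integral_const_mul, hI, hL2]
  simp [Fintype.sum_prod_type, Fin.sum_univ_succ]
  rw [hsymm 1 0, hsymm 2 0, hsymm 3 0, hsymm 2 1, hsymm 3 1, hsymm 3 2]
  ring

end GaussianMoments

/-! ### Linear forms in i.i.d. Gaussian coordinates. -/

section LinearForms

variable {J : Type*} [Fintype J]

theorem hasGaussianLaw_pi_gaussianReal (v : NNReal) :
    HasGaussianLaw (fun (ω : J → ℝ) => ω) (Measure.pi fun _ : J => gaussianReal 0 v) := by
  refine iIndepFun.hasGaussianLaw (X := fun (j : J) (ω : J → ℝ) => ω j) (fun j => ?_)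
    (iIndepFun_pi (Ω := fun _ : J => ℝ) (𝓧 := fun _ => ℝ)
      (μ := fun _ => gaussianReal 0 v) (X := fun _ => id) fun _ => aemeasurable_id)
  have := measurePreserving_eval (α := fun _ : J => ℝ) (fun _ : J => gaussianReal 0 v) j
  refine ⟨?_⟩
  have h : Measure.map (fun ω : J → ℝ => ω j) (Measure.pi fun _ : J => gaussianReal 0 v) =
      gaussianReal 0 v := this.map_eq
  rw [h]
  infer_instance

theorem integral_dotProduct_pi_gaussianReal (v : NNReal) (u : J → ℝ) :
    ∫ ω, u ⬝ᵥ ω ∂(Measure.pi fun _ : J => gaussianReal 0 v) = 0 := by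
  have hj (j : J) : ∫ ω : J → ℝ, ω j ∂(Measure.pi fun _ : J => gaussianReal 0 v) = 0 := by
    rw [integral_comp_eval (X := fun _ : J => ℝ) (i := j) (f := fun x : ℝ => x) (by fun_prop)]
    simp
  simp only [dotProduct]
  rw [integral_finsetSum _ fun j _ =>
    ((hasGaussianLaw_pi_gaussianReal v).eval j).integrable.const_mul _]
  simp [integral_const_mul, hj]

theorem integral_dotProduct_mul_dotProduct_pi_gaussianReal (v : NNReal) (u w : J → ℝ) :
    ∫ ω, (u ⬝ᵥ ω) * (w ⬝ᵥ ω) ∂(Measure.pi fun _ : J => gaussianReal 0 v) = v * (u ⬝ᵥ w) := by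
  classical
  set ν := Measure.pi fun _ : J => gaussianReal 0 v
  have hG (j : J) : HasGaussianLaw (fun ω : J → ℝ => ω j) ν :=
    (hasGaussianLaw_pi_gaussianReal v).eval j
  have hj (j : J) : ∫ ω : J → ℝ, ω j ∂ν = 0 := by
    rw [integral_comp_eval (X := fun _ : J => ℝ) (i := j) (f := fun x : ℝ => x) (by fun_prop)]
    simp
  have hjj (j : J) : ∫ ω : J → ℝ, ω j * ω j ∂ν = v := by
    rw [integral_comp_eval (X := fun _ : J => ℝ) (i := j) (f := fun x : ℝ => x * x) (by fun_prop)]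
    have := variance_eq_integral (μ := gaussianReal 0 v) (X := fun x => x) (by fun_prop)
    simp only [integral_id_gaussianReal, variance_fun_id_gaussianReal, sub_zero] at this
    simp_rw [← sq]
    exact this.symm
  have hind : iIndepFun (fun (j : J) (ω : J → ℝ) => ω j) ν :=
    iIndepFun_pi (X := fun _ => id) fun _ => aemeasurable_id
  have hij (i j : J) : ∫ ω : J → ℝ, ω i * ω j ∂ν = if i = j then (v : ℝ) else 0 := by
    split_ifs with h
    · subst h; exact hjj i
    · rw [(hind.indepFun h).integral_fun_mul_eq_mul_integral
        (measurable_pi_apply i).aestronglyMeasurable (measurable_pi_apply j).aestronglyMeasurable,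
        hj,
        zero_mul]
  have hmul (i j : J) : Integrable (fun ω : J → ℝ => ω i * ω j) ν :=
    (hG i).memLp_two.integrable_mul (hG j).memLp_two
  have : ∀ ω : J → ℝ, (u ⬝ᵥ ω) * (w ⬝ᵥ ω) = ∑ i, ∑ j, u i * w j * (ω i * ω j) := by
    intro ω
    rw [dotProduct, dotProduct, Finset.sum_mul_sum]
    exact Finset.sum_congr rfl fun i _ => Finset.sum_congr rfl fun j _ => by ring
  simp_rw [this]
  rw [integral_finsetSum _ fun i _ => integrable_finsetSum _ fun j _ => (hmul i j).const_mul _]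
  rw [dotProduct, Finset.mul_sum]
  refine Finset.sum_congr rfl fun i _ => ?_
  rw [integral_finsetSum _ fun j _ => (hmul i j).const_mul _]
  simp [integral_const_mul, hij]
  ring

theorem integral_dotProduct_four_pi_gaussianReal (v : NNReal) (u : Fin 4 → J → ℝ) :
    ∫ ω, (u 0 ⬝ᵥ ω) * (u 1 ⬝ᵥ ω) * (u 2 ⬝ᵥ ω) * (u 3 ⬝ᵥ ω)
        ∂(Measure.pi fun _ : J => gaussianReal 0 v) =
      (v : ℝ) ^ 2 * ((u 0 ⬝ᵥ u 1) * (u 2 ⬝ᵥ u 3) + (u 0 ⬝ᵥ u 2) * (u 1 ⬝ᵥ u 3) +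
        (u 0 ⬝ᵥ u 3) * (u 1 ⬝ᵥ u 2)) := by
  have hG : HasGaussianLaw (fun (ω : J → ℝ) (i : Fin 4) => u i ⬝ᵥ ω)
      (Measure.pi fun _ : J => gaussianReal 0 v) :=
    (hasGaussianLaw_pi_gaussianReal v).map_fun
      (LinearMap.toContinuousLinearMap (Matrix.mulVecLin (Matrix.of u)))
  rw [HasGaussianLaw.integral_prod_four hG fun i => integral_dotProduct_pi_gaussianReal v (u i)]
  simp_rw [integral_dotProduct_mul_dotProduct_pi_gaussianReal]
  ring

end LinearForms

/-! ### Algebra of the output, its derivatives and the overlaps. -/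

section Deterministic

/-- The entry `∑_s ω^s_{a b} f^s` of a site tensor `ω` contracted with a feature vector `f`. -/
def contract {r N M : ℕ} (f : Fin r → ℝ) (ω : Fin r × Fin N × Fin M → ℝ) (a : Fin N) (b : Fin M) :
    ℝ :=
  ∑ s, ω (s, a, b) * f s

variable {n : ℕ} [NeZero n] {d : Fin n → ℕ} {X : Fin n → Type*}
  (φ : (k : Fin n) → X k → Fin (d k) → ℝ) (α : Fin n → ℕ+)

/-- The product of all contracted site tensors except the one at `k`, summed over the bond
configurations with prescribed values at the two bonds of site `k`. -/
def openChain (A : Param d α → ℝ) (x : (k : Fin n) → X k) (k : Fin n)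
    (a : Fin (α k : ℕ)) (b : Fin (α (k + 1) : ℕ)) : ℝ :=
  ∑ c : ((l : Fin n) → Fin (α l : ℕ)), if c k = a ∧ c (k + 1) = b then
    ∏ l ∈ Finset.univ.erase k, contract (φ l (x l)) (fun j => A ⟨l, j⟩) (c l) (c (l + 1)) else 0

variable {φ α}

theorem output_eq_sum_prod_contract (A : Param d α → ℝ) (x : (k : Fin n) → X k) :
    output φ α A x = ∑ c : ((l : Fin n) → Fin (α l : ℕ)),
      ∏ l, contract (φ l (x l)) (fun j => A ⟨l, j⟩) (c l) (c (l + 1)) := by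
  unfold output contract
  rw [Finset.sum_comm]
  refine Finset.sum_congr rfl fun c _ => ?_
  rw [Fintype.prod_sum]
  exact Finset.sum_congr rfl fun s _ => Finset.prod_mul_distrib.symm

theorem contract_update_of_ne (A : Param d α → ℝ) {k l : Fin n} (h : l ≠ k)
    (q : Fin (d k) × Fin (α k : ℕ) × Fin (α (k + 1) : ℕ)) (t : ℝ) :
    (fun j => Function.update A ⟨k, q⟩ t ⟨l, j⟩) = fun j => A ⟨l, j⟩ := by
  funext j
  refine Function.update_of_ne (fun e => h ?_) _ _
  exact congrArg Sigma.fst e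

theorem contract_update_self (A : Param d α → ℝ) (k : Fin n) (f : Fin (d k) → ℝ) (s : Fin (d k))
    (a a' : Fin (α k : ℕ)) (b b' : Fin (α (k + 1) : ℕ)) (t : ℝ) :
    contract f (fun j => Function.update A ⟨k, s, a, b⟩ t ⟨k, j⟩) a' b' =
      contract f (fun j => A ⟨k, j⟩) a' b' +
        (t - A ⟨k, s, a, b⟩) * (if a' = a ∧ b' = b then f s else 0) := by
  unfold contract
  have (s' : Fin (d k)) : Function.update A ⟨k, s, a, b⟩ t ⟨k, s', a', b'⟩ * f s' =
      A ⟨k, s', a', b'⟩ * f s' + (if s' = s then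
        (t - A ⟨k, s, a, b⟩) * (if a' = a ∧ b' = b then f s else 0) else 0) := by
    by_cases h : s' = s
    · subst h
      by_cases h' : a' = a ∧ b' = b
      · obtain ⟨rfl, rfl⟩ := h'
        simp; ring
      · rw [Function.update_of_ne (by simpa using h')]
        simp [h']
    · rw [Function.update_of_ne (by simp [h])]
      simp [h]
  simp [this, Finset.sum_add_distrib]

/-- Each monomial of the output uses exactly one entry from site `k`, so the dependence on a single
entry is affine, with slope independent of that entry. -/
theorem output_update (A : Param d α → ℝ) (x : (k : Fin n) → X k) (k : Fin n) (s : Fin (d k))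
    (a : Fin (α k : ℕ)) (b : Fin (α (k + 1) : ℕ)) (t : ℝ) :
    output φ α (Function.update A ⟨k, s, a, b⟩ t) x =
      output φ α A x + (t - A ⟨k, s, a, b⟩) * (φ k (x k) s * openChain φ α A x k a b) := by
  simp only [output_eq_sum_prod_contract, openChain, Finset.mul_sum]
  rw [← Finset.sum_add_distrib]
  refine Finset.sum_congr rfl fun c _ => ?_
  rw [← Finset.mul_prod_erase _ _ (Finset.mem_univ k),
    ← Finset.mul_prod_erase (a := k) Finset.univ (fun l => contract (φ l (x l))
      (fun j => A ⟨l, j⟩) (c l) (c (l + 1))) (Finset.mem_univ k), contract_update_self]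
  have : ∏ l ∈ Finset.univ.erase k, contract (φ l (x l))
      (fun j => Function.update A ⟨k, s, a, b⟩ t ⟨l, j⟩) (c l) (c (l + 1)) =
      ∏ l ∈ Finset.univ.erase k, contract (φ l (x l)) (fun j => A ⟨l, j⟩) (c l) (c (l + 1)) :=
    Finset.prod_congr rfl fun l hl => by
      rw [contract_update_of_ne A (Finset.ne_of_mem_erase hl)]
  rw [this]
  split_ifs <;> ring

theorem partialOutput_eq (A : Param d α → ℝ) (x : (k : Fin n) → X k) (k : Fin n) (s : Fin (d k))
    (a : Fin (α k : ℕ)) (b : Fin (α (k + 1) : ℕ)) :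
    partialOutput φ α A x ⟨k, s, a, b⟩ = φ k (x k) s * openChain φ α A x k a b := by
  unfold partialOutput
  simp only [output_update]
  refine HasDerivAt.deriv ?_
  simpa using (((hasDerivAt_id (A ⟨k, s, a, b⟩)).sub_const (A ⟨k, s, a, b⟩)).mul_const
    (φ k (x k) s * openChain φ α A x k a b)).const_add (output φ α A x)

/-- Doubles the configuration space: applied once it gives the overlap, applied again its square,
always as one sum over configurations of a product over sites. -/
theorem sum_pi_mul_sum_pi {ι R : Type*} [Fintype ι] [DecidableEq ι] [CommSemiring R]
    {β γ : ι → Type*} [∀ i, Fintype (β i)] [∀ i, Fintype (γ i)]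
    (f : (∀ i, β i) → R) (g : (∀ i, γ i) → R) :
    (∑ c, f c) * ∑ c, g c =
      ∑ e : (∀ i, β i × γ i), f (fun i => (e i).1) * g (fun i => (e i).2) := by
  rw [Finset.sum_mul_sum, ← Fintype.sum_prod_type',
    ← (Equiv.arrowProdEquivProdArrow ι β γ).sum_comp]
  rfl

/-- The factor of site `l` in the sum over pairs of bond configurations that gives the
kernel of site `k`. -/
def pairFactor (k l : Fin n) {r N M : ℕ} (f g : Fin r → ℝ) (ω : Fin r × Fin N × Fin M → ℝ)
    (e : Fin N × Fin N) (e' : Fin M × Fin M) : ℝ :=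
  if l = k then (if e.1 = e.2 then 1 else 0) * (if e'.1 = e'.2 then 1 else 0)
  else contract f ω e.1 e'.1 * contract g ω e.2 e'.2

/-- The sum `∑_{a b} M(x)_{a b} M(y)_{a b}`, where `M` is the open chain at site `k`, as a sum
over pairs of bond configurations. -/
def overlap (φ : (k : Fin n) → X k → Fin (d k) → ℝ) (α : Fin n → ℕ+) (A : Param d α → ℝ)
    (x y : (k : Fin n) → X k) (k : Fin n) : ℝ :=
  ∑ c : ((l : Fin n) → Fin (α l : ℕ) × Fin (α l : ℕ)),
    ∏ l, pairFactor k l (φ l (x l)) (φ l (y l)) (fun j => A ⟨l, j⟩) (c l) (c (l + 1))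

/-- Summing over `a`, `b` identifies the two copies at both bonds of site `k`; these Kronecker
deltas serve as the factor of the missing site, so all sites enter one cyclic product. -/
theorem sum_openChain_mul_openChain (A : Param d α → ℝ) (x y : (k : Fin n) → X k) (k : Fin n) :
    ∑ a, ∑ b, openChain φ α A x k a b * openChain φ α A y k a b = overlap φ α A x y k := by
  unfold openChain overlap
  simp_rw [sum_pi_mul_sum_pi]
  simp_rw [Finset.sum_comm (t := (Finset.univ : Finset (∀ l, Fin (α l : ℕ) × Fin (α l : ℕ))))]
  refine Finset.sum_congr rfl fun c _ => ?_
  rw [← Finset.mul_prod_erase _ _ (Finset.mem_univ k)]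
  have : ∏ l ∈ Finset.univ.erase k,
      pairFactor k l (φ l (x l)) (φ l (y l)) (fun j => A ⟨l, j⟩) (c l) (c (l + 1)) =
      (∏ l ∈ Finset.univ.erase k,
        contract (φ l (x l)) (fun j => A ⟨l, j⟩) (c l).1 (c (l + 1)).1) *
      ∏ l ∈ Finset.univ.erase k,
        contract (φ l (y l)) (fun j => A ⟨l, j⟩) (c l).2 (c (l + 1)).2 := by
    rw [← Finset.prod_mul_distrib]
    exact Finset.prod_congr rfl fun l hl => by simp [pairFactor, Finset.ne_of_mem_erase hl]
  rw [this]
  have (a : Fin (α k : ℕ)) (b : Fin (α (k + 1) : ℕ)) (u w : ℝ) :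
      (if (c k).1 = a ∧ (c (k + 1)).1 = b then u else 0) *
        (if (c k).2 = a ∧ (c (k + 1)).2 = b then w else 0) =
      if (c k).1 = a then if (c (k + 1)).1 = b then
        (if (c k).1 = (c k).2 then 1 else 0) *
          (if (c (k + 1)).1 = (c (k + 1)).2 then 1 else 0) * (u * w) else 0 else 0 := by
    by_cases h1 : (c k).1 = a
    · by_cases h2 : (c (k + 1)).1 = b
      · subst h1 h2
        simp only [ite_and, eq_comm (a := (c k).2), eq_comm (a := (c (k + 1)).2)]
        split_ifs <;> simp_all
      · simp [h2]
    · simp [h1]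
  simp_rw [this]
  simp [pairFactor]

theorem ntk_eq_sum_overlap (A : Param d α → ℝ) (x y : (k : Fin n) → X k) :
    ntk φ α A x y =
      ∑ k, (φ k (x k) ⬝ᵥ φ k (y k)) * (learningRate α k * overlap φ α A x y k) := by
  unfold ntk
  rw [Fintype.sum_sigma]
  refine Finset.sum_congr rfl fun k _ => ?_
  simp_rw [Fintype.sum_prod_type, partialOutput_eq, ← sum_openChain_mul_openChain, dotProduct,
    Finset.sum_mul, Finset.mul_sum]
  refine Finset.sum_congr rfl fun s _ => Finset.sum_congr rfl fun a _ =>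
    Finset.sum_congr rfl fun b _ => by ring

theorem overlap_sq (A : Param d α → ℝ) (x y : (k : Fin n) → X k) (k : Fin n) :
    overlap φ α A x y k ^ 2 =
      ∑ e : ((l : Fin n) →
          (Fin (α l : ℕ) × Fin (α l : ℕ)) × (Fin (α l : ℕ) × Fin (α l : ℕ))),
        ∏ l, (pairFactor k l (φ l (x l)) (φ l (y l)) (fun j => A ⟨l, j⟩) (e l).1 (e (l + 1)).1 *
          pairFactor k l (φ l (x l)) (φ l (y l)) (fun j => A ⟨l, j⟩) (e l).2 (e (l + 1)).2) := by
  rw [sq, overlap, sum_pi_mul_sum_pi]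
  simp_rw [Finset.prod_mul_distrib]

end Deterministic

/-! ### Gaussian integrals over one site tensor. -/

section SiteIntegrals

variable {r N M : ℕ}

/-- The coefficient vector of the linear form `ω ↦ contract f ω a b`. -/
def siteVector (f : Fin r → ℝ) (a : Fin N) (b : Fin M) : Fin r × Fin N × Fin M → ℝ :=
  fun j => if j.2.1 = a then if j.2.2 = b then f j.1 else 0 else 0

theorem contract_eq_dotProduct (f : Fin r → ℝ) (ω : Fin r × Fin N × Fin M → ℝ) (a : Fin N)
    (b : Fin M) : contract f ω a b = siteVector f a b ⬝ᵥ ω := by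
  simp [contract, siteVector, dotProduct, Fintype.sum_prod_type, mul_comm]

theorem siteVector_dotProduct (f g : Fin r → ℝ) (a a' : Fin N) (b b' : Fin M) :
    siteVector f a b ⬝ᵥ siteVector g a' b' =
      (f ⬝ᵥ g) * ((if a = a' then 1 else 0) * (if b = b' then 1 else 0)) := by
  by_cases h1 : a = a' <;> by_cases h2 : b = b' <;>
    simp [siteVector, dotProduct, Fintype.sum_prod_type, h1, h2, eq_comm (a := a'),
      eq_comm (a := b')]

theorem continuous_contract (f : Fin r → ℝ) (a : Fin N) (b : Fin M) :
    Continuous fun ω : Fin r × Fin N × Fin M → ℝ => contract f ω a b := by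
  unfold contract; fun_prop

theorem continuous_pairFactor {n : ℕ} (k l : Fin n) (f g : Fin r → ℝ) (e : Fin N × Fin N)
    (e' : Fin M × Fin M) :
    Continuous fun ω : Fin r × Fin N × Fin M → ℝ => pairFactor k l f g ω e e' := by
  have h := continuous_contract (N := N) (M := M) (r := r)
  unfold pairFactor
  by_cases hl : l = k
  · simp only [hl, if_true]; fun_prop
  · simp only [hl, if_false]; exact (h _ _ _).mul (h _ _ _)

theorem integral_pairFactor {n : ℕ} (k l : Fin n) (v : NNReal) (f g : Fin r → ℝ)
    (e : Fin N × Fin N) (e' : Fin M × Fin M) :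
    ∫ ω, pairFactor k l f g ω e e' ∂(Measure.pi fun _ => gaussianReal 0 v) =
      (if l = k then 1 else v * (f ⬝ᵥ g)) *
        ((if e.1 = e.2 then 1 else 0) * (if e'.1 = e'.2 then 1 else 0)) := by
  unfold pairFactor
  by_cases h : l = k
  · simp [h]
  · simp only [h, if_false, contract_eq_dotProduct,
      integral_dotProduct_mul_dotProduct_pi_gaussianReal, siteVector_dotProduct]
    ring

/-- The indicator of the quadruples whose entries agree along the pairing `p` of the four
positions. -/
def pairing {β : Type*} [DecidableEq β] (p : Fin 3) (e : (β × β) × (β × β)) : ℝ :=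
  (![(if e.1.1 = e.1.2 then 1 else 0) * (if e.2.1 = e.2.2 then 1 else 0),
    (if e.1.1 = e.2.1 then 1 else 0) * (if e.1.2 = e.2.2 then 1 else 0),
    (if e.1.1 = e.2.2 then 1 else 0) * (if e.1.2 = e.2.1 then 1 else 0)] : Fin 3 → ℝ) p

/-- Equal pairings leave two free indices. Two different pairings together connect all four
positions and leave one. This lost factor is what makes the variance vanish. -/
theorem sum_pairing_mul_pairing {β : Type*} [DecidableEq β] [Fintype β] (p q : Fin 3) :
    ∑ e : (β × β) × (β × β), pairing p e * pairing q e =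
      if p = q then (Fintype.card β : ℝ) ^ 2 else Fintype.card β := by
  have hne (h : p ≠ q) (a b c d : β) : pairing p ((a, b), (c, d)) * pairing q ((a, b), (c, d)) =
      if a = b then if a = c then if a = d then (1 : ℝ) else 0 else 0 else 0 := by
    fin_cases p <;> fin_cases q <;> simp [pairing] at h ⊢ <;> grind
  simp only [Fintype.sum_prod_type]
  by_cases h : p = q
  · subst h
    fin_cases p <;> simp [pairing, sq]
  · simp [hne h, h]

/-- The weight of the pairing `p` in the fourth moment of a site. -/
def pairingWeight (f g : Fin r → ℝ) (p : Fin 3) : ℝ :=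
  (![(f ⬝ᵥ g) ^ 2, (f ⬝ᵥ f) * (g ⬝ᵥ g), (f ⬝ᵥ g) ^ 2] : Fin 3 → ℝ) p

/-- Isserlis' theorem splits each term into a function of the left bond times a function of the
right bond. The deterministic factor of the removed site has the same shape, with pairing `0` alone.
-/
theorem integral_pairFactor_mul_pairFactor {n : ℕ} (k l : Fin n) (v : NNReal) (f g : Fin r → ℝ)
    (e : (Fin N × Fin N) × (Fin N × Fin N)) (e' : (Fin M × Fin M) × (Fin M × Fin M)) :
    ∫ ω, pairFactor k l f g ω e.1 e'.1 * pairFactor k l f g ω e.2 e'.2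
        ∂(Measure.pi fun _ => gaussianReal 0 v) =
      ∑ p, (if l = k then (if p = 0 then 1 else 0) else (v : ℝ) ^ 2 * pairingWeight f g p) *
        (pairing p e * pairing p e') := by
  unfold pairFactor
  by_cases h : l = k
  · simp only [h, if_true, Fin.sum_univ_three, pairing, Matrix.cons_val]
    simp only [one_ne_zero, if_false, zero_mul, add_zero, one_mul, integral_const,
      probReal_univ, smul_eq_mul,
      (by decide : (2 : Fin 3) ≠ 0)]
    ring
  · have := integral_dotProduct_four_pi_gaussianReal v
      ![siteVector f e.1.1 e'.1.1, siteVector g e.1.2 e'.1.2, siteVector f e.2.1 e'.2.1,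
        siteVector g e.2.2 e'.2.2]
    simp only [h, if_false, contract_eq_dotProduct]
    simp only [Matrix.cons_val, siteVector_dotProduct] at this
    simp_rw [← mul_assoc, this]
    simp only [pairing, pairingWeight, Fin.sum_univ_three, Matrix.cons_val, dotProduct_comm g f]
    ring

end SiteIntegrals

/-! ### Independence of the site tensors. -/

section Law

variable {n : ℕ} [NeZero n] {d : Fin n → ℕ} {σ : Fin n → ℝ} {α : Fin n → ℕ+}
  {Ω : Type*} [MeasurableSpace Ω] {μ : Measure Ω} {A : Ω → Param d α → ℝ}

theorem IsGaussianInit.hasLaw_curry (hA : IsGaussianInit μ σ α A) :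
    HasLaw (fun ω (k : Fin n) (j : Fin (d k) × Fin (α k : ℕ) × Fin (α (k + 1) : ℕ)) => A ω ⟨k, j⟩)
      (Measure.pi fun k => Measure.pi fun _ => gaussianReal 0 (initVariance σ α k)) μ := by
  have hm : AEMeasurable A μ := aemeasurable_pi_iff.2 fun p => (hA.law p).aemeasurable
  have h1 := hA.indep.hasLaw_infinitePi hA.law hm
  have h2 := Measure.infinitePi_map_piCurry
    (κ := fun k : Fin n => Fin (d k) × Fin (α k : ℕ) × Fin (α (k + 1) : ℕ))
    (X := fun _ _ => ℝ) (fun k _ => gaussianReal 0 (initVariance σ α k))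
  simp only [Measure.infinitePi_eq_pi] at h1 h2
  have h3 : HasLaw (MeasurableEquiv.piCurry (κ := fun k : Fin n => Fin (d k) × Fin (α k : ℕ) ×
      Fin (α (k + 1) : ℕ)) (fun _ _ => ℝ)) (Measure.pi fun k => Measure.pi fun _ =>
        gaussianReal 0 (initVariance σ α k)) (Measure.pi fun p : Param d α =>
          gaussianReal 0 (initVariance σ α p.1)) := ⟨by fun_prop, h2⟩
  exact h3.comp h1

theorem IsGaussianInit.integral_prod_sites (hA : IsGaussianInit μ σ α A)
    (F : (k : Fin n) → (Fin (d k) × Fin (α k : ℕ) × Fin (α (k + 1) : ℕ) → ℝ) → ℝ)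
    (hF : ∀ k, Continuous (F k)) :
    ∫ ω, ∏ k, F k (fun j => A ω ⟨k, j⟩) ∂μ =
      ∏ k, ∫ w, F k w ∂(Measure.pi fun _ => gaussianReal 0 (initVariance σ α k)) := by
  rw [← integral_fintype_prod_eq_prod]
  have hc : Continuous fun w : ((k : Fin n) →
      (Fin (d k) × Fin (α k : ℕ) × Fin (α (k + 1) : ℕ) → ℝ)) => ∏ k, F k (w k) :=
    continuous_finsetProd _ fun k _ => (hF k).comp (continuous_apply k)
  exact hA.hasLaw_curry.integral_comp hc.aestronglyMeasurable

end Law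

/-! ### Integrability. -/

section Moments

variable {Ω : Type*} [MeasurableSpace Ω] {μ : Measure Ω}

/-- All moments of `f` are finite. -/
def HasMoments (μ : Measure Ω) (f : Ω → ℝ) : Prop := ∀ p : ENNReal, p ≠ ⊤ → MemLp f p μ

/-- Hölder with exponents `2p`, `2p`, `p`. Requiring all finite exponents is what makes the class
closed under products. -/
theorem HasMoments.mul {f g : Ω → ℝ} (hf : HasMoments μ f) (hg : HasMoments μ g) :
    HasMoments μ fun ω => f ω * g ω := fun p hp => by
  have h2 : 2 * p ≠ ⊤ := ENNReal.mul_ne_top (by simp) hp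
  have : ENNReal.HolderTriple (2 * p) (2 * p) p := ⟨by
    rw [ENNReal.mul_inv (by simp) (by simp), ← add_mul, ENNReal.inv_two_add_inv_two, one_mul]⟩
  exact (hg _ h2).mul' (hf _ h2)

theorem HasMoments.sum {ι : Type*} {s : Finset ι} {f : ι → Ω → ℝ}
    (hf : ∀ i ∈ s, HasMoments μ (f i)) : HasMoments μ fun ω => ∑ i ∈ s, f i ω := fun p hp =>
  memLp_finsetSum _ fun i hi => hf i hi p hp

theorem hasMoments_const [IsFiniteMeasure μ] (c : ℝ) : HasMoments μ fun _ => c :=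
  fun _ _ => memLp_const c

theorem HasMoments.prod [IsFiniteMeasure μ] {ι : Type*} {s : Finset ι} {f : ι → Ω → ℝ}
    (hf : ∀ i ∈ s, HasMoments μ (f i)) : HasMoments μ fun ω => ∏ i ∈ s, f i ω := by
  induction s using Finset.cons_induction with
  | empty => simpa using hasMoments_const 1
  | cons i s hi ih =>
    simp only [Finset.prod_cons]
    exact (hf i (by simp)).mul (ih fun j hj => hf j (by simp [hj]))

theorem HasMoments.integrable {f : Ω → ℝ} (hf : HasMoments μ f) : Integrable f μ :=
  memLp_one_iff_integrable.1 (hf 1 (by simp))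

variable {n : ℕ} [NeZero n] {d : Fin n → ℕ} {σ : Fin n → ℝ}
  {α : Fin n → ℕ+} {A : Ω → Param d α → ℝ}

theorem IsGaussianInit.hasMoments (hA : IsGaussianInit μ σ α A) (p : Param d α) :
    HasMoments μ fun ω => A ω p := fun _ hq =>
  (hA.law p).hasGaussianLaw.memLp hq

variable [IsProbabilityMeasure μ]

theorem IsGaussianInit.hasMoments_pairFactor (hA : IsGaussianInit μ σ α A) (k l : Fin n)
    (f g : Fin (d l) → ℝ) (e : Fin (α l : ℕ) × Fin (α l : ℕ))
    (e' : Fin (α (l + 1) : ℕ) × Fin (α (l + 1) : ℕ)) :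
    HasMoments μ fun ω => pairFactor k l f g (fun j => A ω ⟨l, j⟩) e e' := by
  unfold pairFactor
  split_ifs
  all_goals first | exact hasMoments_const _ | skip
  unfold contract
  exact (HasMoments.sum fun s _ => (hA.hasMoments _).mul (hasMoments_const _)).mul
    (HasMoments.sum fun s _ => (hA.hasMoments _).mul (hasMoments_const _))

theorem IsGaussianInit.hasMoments_overlap (hA : IsGaussianInit μ σ α A) {X : Fin n → Type*}
    (φ : (k : Fin n) → X k → Fin (d k) → ℝ) (x y : (k : Fin n) → X k) (k : Fin n) :
    HasMoments μ fun ω => overlap φ α (A ω) x y k :=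
  HasMoments.sum fun _ _ => HasMoments.prod fun _ _ => hA.hasMoments_pairFactor _ _ _ _ _ _

end Moments

/-! ### Sums and normalizations around the ring. -/

section Cyclic

variable {n : ℕ} [NeZero n]

/-- A transfer computation: regrouping by bonds, bond `l` meets only sites `l` and `l - 1`, so for
fixed labels `p` the bond sums decouple. -/
theorem sum_prod_cyclic {κ : Type*} {β : Fin n → Type*} [∀ l, Fintype (β l)]
    (w : Fin n → ℝ) (H : (l : Fin n) → κ → β l → ℝ) (p : Fin n → κ) :
    ∑ c : ((l : Fin n) → β l), ∏ l, (w l * (H l (p l) (c l) * H (l + 1) (p l) (c (l + 1)))) =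
      (∏ l, w l) * ∏ l, ∑ e, H l (p l) e * H l (p (l - 1)) e := by
  rw [Fintype.prod_sum, Finset.mul_sum]
  refine Finset.sum_congr rfl fun c _ => ?_
  rw [Finset.prod_mul_distrib, Finset.prod_mul_distrib, Finset.prod_mul_distrib]
  congr 2
  rw [← Equiv.prod_comp (Equiv.addRight (1 : Fin n)) (fun l => H l (p (l - 1)) (c l))]
  simp

/-- Each bond dimension occurs at two adjacent sites, so its square roots pair up. -/
theorem prod_sqrt_mul_succ (α : Fin n → ℕ+) :
    ∏ l, √((α l : ℝ) * (α (l + 1) : ℝ)) = ∏ l, (α l : ℝ) := by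
  simp_rw [Real.sqrt_mul (Nat.cast_nonneg _)]
  rw [Finset.prod_mul_distrib,
    show ∏ l, √(α (l + 1) : ℝ) = ∏ l, √(α l : ℝ) from
      Equiv.prod_comp (Equiv.addRight (1 : Fin n)) (fun l => √(α l : ℝ)), ← Finset.prod_mul_distrib]
  exact Finset.prod_congr rfl fun l _ => Real.mul_self_sqrt (Nat.cast_nonneg _)

/-- The learning rate supplies the normalization missing at the removed site, so that all sites are
scaled alike. -/
theorem inv_mul_prod_ite {ι : Type*} [Fintype ι] [DecidableEq ι] (r u t : ι → ℝ) (k : ι) :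
    (r k)⁻¹ * ∏ l, (if l = k then u l else (r l)⁻¹ * t l) =
      (∏ l, r l)⁻¹ * ∏ l, if l = k then u l else t l := by
  rw [← Finset.prod_inv_distrib, ← Finset.prod_mul_distrib,
    ← Finset.mul_prod_erase _ _ (Finset.mem_univ k),
    ← Finset.mul_prod_erase (a := k) Finset.univ (fun l => (r l)⁻¹ * if l = k then u l else t l)
      (Finset.mem_univ k)]
  have : ∏ l ∈ Finset.univ.erase k, (if l = k then u l else (r l)⁻¹ * t l) =
      ∏ l ∈ Finset.univ.erase k, ((r l)⁻¹ * if l = k then u l else t l) :=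
    Finset.prod_congr rfl fun l hl => by simp [Finset.ne_of_mem_erase hl]
  rw [this]
  simp only [if_true]
  ring

theorem prod_ite_eq_prod_erase {ι : Type*} [Fintype ι] [DecidableEq ι] (t : ι → ℝ) (k : ι) :
    ∏ l, (if l = k then 1 else t l) = ∏ l ∈ Finset.univ.erase k, t l := by
  rw [← Finset.mul_prod_erase _ _ (Finset.mem_univ k)]
  simp only [if_true, one_mul]
  exact Finset.prod_congr rfl fun l hl => by simp [Finset.ne_of_mem_erase hl]

theorem eq_of_forall_eq_sub_one {κ : Type*} (p : Fin n → κ) (h : ∀ l, p l = p (l - 1))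
    (k l : Fin n) : p l = p k := by
  obtain ⟨m, rfl⟩ : ∃ m, n = m + 1 := ⟨n - 1, (Nat.succ_pred (NeZero.ne n)).symm⟩
  have h0 (l : Fin (m + 1)) : p l = p 0 := by
    induction l using Fin.induction with
    | zero => rfl
    | succ i ih => rw [← ih, h i.succ, ← Fin.coeSucc_eq_succ, add_sub_cancel_right]
  rw [h0 l, h0 k]

theorem learningRate_eq (α : Fin n → ℕ+) (k : Fin n) :
    learningRate α k = (√((α k : ℝ) * (α (k + 1) : ℝ)))⁻¹ := by
  rw [learningRate, Real.rpow_neg (by positivity), Real.sqrt_eq_rpow]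

theorem coe_initVariance (σ : Fin n → ℝ) (α : Fin n → ℕ+) (k : Fin n) :
    (initVariance σ α k : ℝ) = (√((α k : ℝ) * (α (k + 1) : ℝ)))⁻¹ * σ k ^ 2 := by
  rw [mul_comm]; rfl

end Cyclic

/-! ### First and second moments of the normalized overlap. -/

section OverlapMoments

variable {Ω : Type*} [MeasurableSpace Ω] {μ : Measure Ω} [IsProbabilityMeasure μ]
  {n : ℕ} [NeZero n] {d : Fin n → ℕ} {X : Fin n → Type*} {σ : Fin n → ℝ} {α : Fin n → ℕ+}
  {A : Ω → Param d α → ℝ}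

theorem IsGaussianInit.integral_overlap (hA : IsGaussianInit μ σ α A)
    (φ : (k : Fin n) → X k → Fin (d k) → ℝ) (x y : (k : Fin n) → X k) (k : Fin n) :
    learningRate α k * ∫ ω, overlap φ α (A ω) x y k ∂μ =
      ∏ l ∈ Finset.univ.erase k, σ l ^ 2 * (φ l (x l) ⬝ᵥ φ l (y l)) := by
  unfold overlap
  rw [integral_finsetSum _ fun c _ => (HasMoments.prod fun l _ =>
    hA.hasMoments_pairFactor k l _ _ _ _).integrable]
  have hc (c : (l : Fin n) → Fin (α l : ℕ) × Fin (α l : ℕ)) :=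
    hA.integral_prod_sites (fun l w => pairFactor k l (φ l (x l)) (φ l (y l)) w (c l) (c (l + 1)))
      fun l => continuous_pairFactor _ _ _ _ _ _
  simp_rw [hc, integral_pairFactor]
  rw [sum_prod_cyclic (β := fun l => Fin (α l : ℕ) × Fin (α l : ℕ))
    (fun l => if l = k then 1 else (initVariance σ α l : ℝ) * (φ l (x l) ⬝ᵥ φ l (y l)))
    (fun _ (_ : Unit) e => if e.1 = e.2 then (1 : ℝ) else 0) (fun _ => ())]
  have hs (l : Fin n) : ∑ e : Fin (α l : ℕ) × Fin (α l : ℕ),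
      ((if e.1 = e.2 then (1 : ℝ) else 0) * if e.1 = e.2 then 1 else 0) = α l := by
    simp [Fintype.sum_prod_type]
  simp_rw [hs, coe_initVariance, mul_assoc]
  rw [learningRate_eq, ← mul_assoc, inv_mul_prod_ite (fun l => √((α l : ℝ) * (α (l + 1) : ℝ)))
    (fun _ => 1), prod_sqrt_mul_succ, prod_ite_eq_prod_erase]
  have : ∏ l, (α l : ℝ) ≠ 0 := Finset.prod_ne_zero_iff.2 fun l _ => by simp
  field_simp

theorem IsGaussianInit.integral_overlap_sq (hA : IsGaussianInit μ σ α A)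
    (φ : (k : Fin n) → X k → Fin (d k) → ℝ) (x y : (k : Fin n) → X k) (k : Fin n) :
    learningRate α k ^ 2 * ∫ ω, overlap φ α (A ω) x y k ^ 2 ∂μ =
      ∑ p : Fin n → Fin 3, (∏ l, if l = k then (if p l = 0 then 1 else 0) else
        (σ l ^ 2) ^ 2 * pairingWeight (φ l (x l)) (φ l (y l)) (p l)) *
        ∏ l, if p l = p (l - 1) then 1 else (α l : ℝ)⁻¹ := by
  simp_rw [overlap_sq]
  rw [integral_finsetSum _ fun c _ => (HasMoments.prod fun l _ =>
    (hA.hasMoments_pairFactor k l _ _ _ _).mul (hA.hasMoments_pairFactor k l _ _ _ _)).integrable]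
  have he (e : (l : Fin n) → (Fin (α l : ℕ) × Fin (α l : ℕ)) × (Fin (α l : ℕ) × Fin (α l : ℕ))) :=
    hA.integral_prod_sites (fun l w =>
      pairFactor k l (φ l (x l)) (φ l (y l)) w (e l).1 (e (l + 1)).1 *
        pairFactor k l (φ l (x l)) (φ l (y l)) w (e l).2 (e (l + 1)).2)
      fun l => (continuous_pairFactor _ _ _ _ _ _).mul (continuous_pairFactor _ _ _ _ _ _)
  simp_rw [he, integral_pairFactor_mul_pairFactor, Fintype.prod_sum]
  rw [Finset.sum_comm, Finset.mul_sum]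
  refine Finset.sum_congr rfl fun p _ => ?_
  rw [sum_prod_cyclic
    (β := fun l => (Fin (α l : ℕ) × Fin (α l : ℕ)) × (Fin (α l : ℕ) × Fin (α l : ℕ)))
    (fun l => if l = k then (if p l = 0 then 1 else 0) else
      (initVariance σ α l : ℝ) ^ 2 * pairingWeight (φ l (x l)) (φ l (y l)) (p l))
    (fun _ q e => pairing q e) p]
  have hs (l : Fin n) : (∑ e : (Fin (α l : ℕ) × Fin (α l : ℕ)) × (Fin (α l : ℕ) × Fin (α l : ℕ)),
      pairing (p l) e * pairing (p (l - 1)) e) =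
      (α l : ℝ) ^ 2 * if p l = p (l - 1) then 1 else (α l : ℝ)⁻¹ := by
    have : (α l : ℝ) ≠ 0 := by simp
    rw [sum_pairing_mul_pairing, Fintype.card_fin]
    split_ifs
    · simp
    · field_simp
  simp_rw [hs, coe_initVariance, mul_pow, mul_assoc]
  rw [learningRate_eq, ← mul_assoc, inv_pow]
  simp_rw [inv_pow]
  rw [inv_mul_prod_ite (fun l => √((α l : ℝ) * (α (l + 1) : ℝ)) ^ 2)
    (fun l => if p l = 0 then 1 else 0), Finset.prod_pow, prod_sqrt_mul_succ,
    Finset.prod_mul_distrib (f := fun l => (α l : ℝ) ^ 2), Finset.prod_pow]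
  have : ∏ l, (α l : ℝ) ≠ 0 := Finset.prod_ne_zero_iff.2 fun l _ => by simp
  field_simp

/-- The limit of the second moment of the normalized overlap is the square of its mean. -/
theorem tendsto_second_moment (F : Filter (Fin n → ℕ+))
    (hF : ∀ l, Tendsto (fun α : Fin n → ℕ+ => α l) F atTop)
    {A : (α : Fin n → ℕ+) → Ω → Param d α → ℝ} (hA : ∀ α, IsGaussianInit μ σ α (A α))
    (φ : (k : Fin n) → X k → Fin (d k) → ℝ) (x y : (k : Fin n) → X k) (k : Fin n) :
    Tendsto (fun α => learningRate α k ^ 2 * ∫ ω, overlap φ α (A α ω) x y k ^ 2 ∂μ) F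
      (𝓝 ((∏ l ∈ Finset.univ.erase k, σ l ^ 2 * (φ l (x l) ⬝ᵥ φ l (y l))) ^ 2)) := by
  simp_rw [fun α => (hA α).integral_overlap_sq φ x y k]
  have hlim : (∏ l ∈ Finset.univ.erase k, σ l ^ 2 * (φ l (x l) ⬝ᵥ φ l (y l))) ^ 2 =
      ∑ p : Fin n → Fin 3, (∏ l, if l = k then (if p l = 0 then 1 else 0) else
        (σ l ^ 2) ^ 2 * pairingWeight (φ l (x l)) (φ l (y l)) (p l)) *
        ∏ l, if p l = p (l - 1) then 1 else (0 : ℝ) := by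
    -- A nonconstant assignment vanishes at a mismatched bond, and a constant nonzero one at site
    -- `k`.
    rw [Finset.sum_eq_single (fun _ => 0)]
    · simp only [if_true, Finset.prod_const_one, mul_one, prod_ite_eq_prod_erase]
      rw [← Finset.prod_pow]
      exact Finset.prod_congr rfl fun l _ => by simp [pairingWeight, mul_pow]
    · intro p _ hp
      by_cases h : ∀ l, p l = p (l - 1)
      · have hk : p k ≠ 0 := fun hk => hp (funext fun l => by
          rw [eq_of_forall_eq_sub_one p h k l, hk])
        rw [Finset.prod_eq_zero (Finset.mem_univ k) (by simp [hk]), zero_mul]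
      · push Not at h
        obtain ⟨l, hl⟩ := h
        rw [Finset.prod_eq_zero (f := fun l => if p l = p (l - 1) then 1 else (0 : ℝ))
          (Finset.mem_univ l) (by simp [hl]), mul_zero]
    · simp
  rw [hlim]
  refine tendsto_finsetSum _ fun p _ => Tendsto.const_mul _ (tendsto_finsetProd _ fun l _ => ?_)
  split_ifs
  · exact tendsto_const_nhds
  · exact tendsto_inv_atTop_zero.comp (tendsto_natCast_atTop_atTop.comp
      (tendsto_PNat_val_atTop_atTop.comp (hF l)))

theorem tendsto_integral_sq_sub (F : Filter (Fin n → ℕ+))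
    (hF : ∀ l, Tendsto (fun α : Fin n → ℕ+ => α l) F atTop)
    {A : (α : Fin n → ℕ+) → Ω → Param d α → ℝ} (hA : ∀ α, IsGaussianInit μ σ α (A α))
    (φ : (k : Fin n) → X k → Fin (d k) → ℝ) (x y : (k : Fin n) → X k) (k : Fin n) :
    Tendsto (fun α => ∫ ω, (learningRate α k * overlap φ α (A α ω) x y k -
      ∏ l ∈ Finset.univ.erase k, σ l ^ 2 * (φ l (x l) ⬝ᵥ φ l (y l))) ^ 2 ∂μ) F (𝓝 0) := by
  set L := ∏ l ∈ Finset.univ.erase k, σ l ^ 2 * (φ l (x l) ⬝ᵥ φ l (y l)) with hL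
  have h (α : Fin n → ℕ+) : ∫ ω, (learningRate α k * overlap φ α (A α ω) x y k - L) ^ 2 ∂μ =
      learningRate α k ^ 2 * ∫ ω, overlap φ α (A α ω) x y k ^ 2 ∂μ - L ^ 2 := by
    have hm := (hA α).hasMoments_overlap φ x y k
    have hm2 : Integrable (fun ω => overlap φ α (A α ω) x y k ^ 2) μ := by
      simpa only [sq] using (hm.mul hm).integrable
    have hexp : ∀ ω, (learningRate α k * overlap φ α (A α ω) x y k - L) ^ 2 =
        learningRate α k ^ 2 * overlap φ α (A α ω) x y k ^ 2 -
          2 * L * learningRate α k * overlap φ α (A α ω) x y k + L ^ 2 := fun ω => by ring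
    simp_rw [hexp]
    have hi : Integrable (fun ω => learningRate α k ^ 2 * overlap φ α (A α ω) x y k ^ 2 -
        2 * L * learningRate α k * overlap φ α (A α ω) x y k) μ :=
      (hm2.const_mul _).sub (hm.integrable.const_mul _)
    rw [integral_add hi (integrable_const _),
      integral_sub (hm2.const_mul _) (hm.integrable.const_mul _), integral_const_mul,
      integral_const_mul, mul_assoc (2 * L), (hA α).integral_overlap φ x y k, ← hL]
    simp
    ring
  simp_rw [h]
  rw [← sub_self (L ^ 2)]
  exact (tendsto_second_moment F hF hA φ x y k).sub_const (L ^ 2)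

end OverlapMoments

/-! ### Convergence in probability by Chebyshev's inequality. -/

section Convergence

variable {Ω : Type*} [MeasurableSpace Ω] {μ : Measure Ω} [IsProbabilityMeasure μ]
  {n : ℕ} [NeZero n] {d : Fin n → ℕ} {X : Fin n → Type*} {σ : Fin n → ℝ}

/-- The neural tangent kernel converges in probability along every filter on which all bond
dimensions go to infinity. -/
theorem tendstoInMeasure_ntk {m : ℕ} (F : Filter (Fin n → ℕ+))
    (hF : ∀ l, Tendsto (fun α : Fin n → ℕ+ => α l) F atTop)
    {A : (α : Fin n → ℕ+) → Ω → Param d α → ℝ} (hA : ∀ α, IsGaussianInit μ σ α (A α))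
    (φ : (k : Fin n) → X k → Fin (d k) → ℝ) (x : Fin m → (k : Fin n) → X k) :
    TendstoInMeasure μ (fun α ω (i j : Fin m) => ntk φ α (A α ω) (x i) (x j)) F
      (fun _ i j => limitKernel φ σ (x i) (x j)) := by
  let L (k : Fin n) (i j : Fin m) : ℝ :=
    ∏ l ∈ Finset.univ.erase k, σ l ^ 2 * (φ l (x i l) ⬝ᵥ φ l (x j l))
  let D (α : Fin n → ℕ+) (k : Fin n) (i j : Fin m) (ω : Ω) : ℝ :=
    (learningRate α k * overlap φ α (A α ω) (x i) (x j) k - L k i j) ^ 2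
  -- An integrable majorant of the squared sup distance: the factor `n` comes from Cauchy–Schwarz
  -- over sites, and the sum over `i`, `j` dominates the maximum.
  let T (α : Fin n → ℕ+) (ω : Ω) : ℝ :=
    ∑ i, ∑ j, (n : ℝ) * ∑ k, (φ k (x i k) ⬝ᵥ φ k (x j k)) ^ 2 * D α k i j ω
  have hDint (α : Fin n → ℕ+) (k : Fin n) (i j : Fin m) : Integrable (D α k i j) μ := by
    have h : HasMoments μ
        fun ω => learningRate α k * overlap φ α (A α ω) (x i) (x j) k - L k i j := fun p hp =>
      (((hA α).hasMoments_overlap φ (x i) (x j) k p hp).const_mul _).sub (memLp_const _)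
    simpa only [D, sq] using (h.mul h).integrable
  have hTint (α : Fin n → ℕ+) : Integrable (T α) μ :=
    integrable_finsetSum _ fun i _ => integrable_finsetSum _ fun j _ =>
      (integrable_finsetSum _ fun k _ => (hDint α k i j).const_mul _).const_mul _
  have hTlim : Tendsto (fun α => ∫ ω, T α ω ∂μ) F (𝓝 0) := by
    have h (α : Fin n → ℕ+) : ∫ ω, T α ω ∂μ =
        ∑ i, ∑ j, (n : ℝ) * ∑ k, (φ k (x i k) ⬝ᵥ φ k (x j k)) ^ 2 * ∫ ω, D α k i j ω ∂μ := by
      rw [integral_finsetSum _ fun i _ => integrable_finsetSum _ fun j _ =>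
        (integrable_finsetSum _ fun k _ => (hDint α k i j).const_mul _).const_mul _]
      refine Finset.sum_congr rfl fun i _ => ?_
      rw [integral_finsetSum _ fun j _ =>
        (integrable_finsetSum _ fun k _ => (hDint α k i j).const_mul _).const_mul _]
      refine Finset.sum_congr rfl fun j _ => ?_
      rw [integral_const_mul, integral_finsetSum _ fun k _ => (hDint α k i j).const_mul _]
      simp_rw [integral_const_mul]
    simp_rw [h]
    have h0 : (0 : ℝ) = ∑ i : Fin m, ∑ j : Fin m, (n : ℝ) *
        ∑ k, (φ k (x i k) ⬝ᵥ φ k (x j k)) ^ 2 * 0 := by simp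
    rw [h0]
    exact tendsto_finsetSum _ fun i _ => tendsto_finsetSum _ fun j _ => Tendsto.const_mul _
      (tendsto_finsetSum _ fun k _ => Tendsto.const_mul _
        (tendsto_integral_sq_sub F hF hA φ (x i) (x j) k))
  have hT0 (α : Fin n → ℕ+) (ω : Ω) : 0 ≤ T α ω :=
    Finset.sum_nonneg fun i _ => Finset.sum_nonneg fun j _ => mul_nonneg (Nat.cast_nonneg _)
      (Finset.sum_nonneg fun k _ => mul_nonneg (sq_nonneg _) (sq_nonneg _))
  have hdist (α : Fin n → ℕ+) (ω : Ω) :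
      dist (fun i j : Fin m => ntk φ α (A α ω) (x i) (x j))
        (fun i j => limitKernel φ σ (x i) (x j)) ^ 2 ≤ T α ω := by
    refine (sq_le_sq₀ dist_nonneg (Real.sqrt_nonneg _)).2 ?_ |>.trans (Real.sq_sqrt (hT0 α ω)).le
    rw [dist_pi_le_iff (Real.sqrt_nonneg _)]
    intro i
    rw [dist_pi_le_iff (Real.sqrt_nonneg _)]
    intro j
    rw [Real.dist_eq]
    refine Real.abs_le_sqrt ?_
    have hterm (i j : Fin m) :
        0 ≤ (n : ℝ) * ∑ k, (φ k (x i k) ⬝ᵥ φ k (x j k)) ^ 2 * D α k i j ω :=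
      mul_nonneg (Nat.cast_nonneg _)
        (Finset.sum_nonneg fun k _ => mul_nonneg (sq_nonneg _) (sq_nonneg _))
    calc (ntk φ α (A α ω) (x i) (x j) - limitKernel φ σ (x i) (x j)) ^ 2
        = (∑ k, (φ k (x i k) ⬝ᵥ φ k (x j k)) *
            (learningRate α k * overlap φ α (A α ω) (x i) (x j) k - L k i j)) ^ 2 := by
          rw [ntk_eq_sum_overlap, limitKernel, ← Finset.sum_sub_distrib]
          simp_rw [← mul_sub]
          rfl
      _ ≤ (n : ℝ) * ∑ k, (φ k (x i k) ⬝ᵥ φ k (x j k)) ^ 2 * D α k i j ω := by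
          refine sq_sum_le_card_mul_sum_sq.trans_eq ?_
          simp [D, mul_pow]
      _ ≤ ∑ j, (n : ℝ) * ∑ k, (φ k (x i k) ⬝ᵥ φ k (x j k)) ^ 2 * D α k i j ω :=
          Finset.single_le_sum (f := fun j => (n : ℝ) *
            ∑ k, (φ k (x i k) ⬝ᵥ φ k (x j k)) ^ 2 * D α k i j ω)
            (fun j _ => hterm i j) (Finset.mem_univ j)
      _ ≤ T α ω :=
          Finset.single_le_sum (f := fun i => ∑ j, (n : ℝ) *
            ∑ k, (φ k (x i k) ⬝ᵥ φ k (x j k)) ^ 2 * D α k i j ω)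
            (fun i _ => Finset.sum_nonneg fun j _ => hterm i j) (Finset.mem_univ i)
  rw [tendstoInMeasure_iff_measureReal_dist]
  intro ε hε
  have hlim : Tendsto (fun α => (∫ ω, T α ω ∂μ) / ε ^ 2) F (𝓝 0) := by
    simpa using hTlim.div_const (ε ^ 2)
  refine squeeze_zero (fun _ => measureReal_nonneg) (fun α => ?_) hlim
  rw [le_div_iff₀ (by positivity), mul_comm]
  -- Markov's inequality for `T` at level `ε ^ 2`.
  refine le_trans ?_ (mul_meas_ge_le_integral_of_nonneg (ae_of_all _ (hT0 α)) (hTint α) (ε ^ 2))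
  refine mul_le_mul_of_nonneg_left (measureReal_mono fun ω hω => ?_) (sq_nonneg ε)
  exact (pow_le_pow_left₀ hε.le hω 2).trans (hdist α ω)

end Convergence

/-! ### Sequential limits send every bond dimension to infinity. -/

section IteratedLimit

variable {n : ℕ}

theorem eventually_iteratedAtTop_eq {ks : List (Fin n)} {j : Fin n} (hj : j ∉ ks)
    (α : Fin n → ℕ+) : ∀ᶠ β in iteratedAtTop ks α, β j = α j := by
  induction ks generalizing α with
  | nil => simp [iteratedAtTop]
  | cons k ks ih =>
    rw [List.mem_cons, not_or] at hj
    rw [iteratedAtTop, eventually_bind]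
    refine Eventually.of_forall fun N => (ih hj.2 _).mono fun β hβ => ?_
    rw [hβ, Function.update_of_ne hj.1]

/-- Coordinate `j` is made large at its own stage; without repetitions in the list, the later, inner
stages leave it unchanged. -/
theorem tendsto_iteratedAtTop {ks : List (Fin n)} (hks : ks.Nodup) {j : Fin n} (hj : j ∈ ks)
    (α : Fin n → ℕ+) : Tendsto (fun β : Fin n → ℕ+ => β j) (iteratedAtTop ks α) atTop := by
  induction ks generalizing α with
  | nil => simp at hj
  | cons k ks ih =>
    rw [List.nodup_cons] at hks
    rw [tendsto_atTop]
    intro b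
    rw [iteratedAtTop, eventually_bind]
    by_cases h : j ∈ ks
    · exact Eventually.of_forall fun N => tendsto_atTop.1 (ih hks.2 h _) b
    · obtain rfl : j = k := by simpa [h] using hj
      filter_upwards [eventually_ge_atTop b] with N hN
      filter_upwards [eventually_iteratedAtTop_eq h (Function.update α j N)] with β hβ
      rwa [hβ, Function.update_self]

theorem tendsto_sequentialAtTop (π : Equiv.Perm (Fin n)) (j : Fin n) :
    Tendsto (fun α : Fin n → ℕ+ => α j) (sequentialAtTop π) atTop := by
  refine tendsto_iteratedAtTop ?_ ?_ _
  · rw [List.nodup_reverse, List.nodup_ofFn]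
    exact π.injective
  · rw [List.mem_reverse, List.mem_ofFn]
    exact π.surjective j

end IteratedLimit

end MPS

end

theorem theorem2 {n : ℕ} [NeZero n] {m : ℕ} {d : Fin n → ℕ} {X : Fin n → Type*}
    (φ : (k : Fin n) → X k → Fin (d k) → ℝ) (σ : Fin n → ℝ)
    (x : Fin m → (k : Fin n) → X k)
    {Ω : Type*} [MeasurableSpace Ω] (μ : Measure Ω) [IsProbabilityMeasure μ]
    (A : (α : Fin n → ℕ+) → Ω → MPS.Param d α → ℝ)
    (hA : ∀ α : Fin n → ℕ+, MPS.IsGaussianInit μ σ α (A α))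
    (π : Equiv.Perm (Fin n)) :
    TendstoInMeasure μ
      (fun (α : Fin n → ℕ+) (ω : Ω) (i j : Fin m) => MPS.ntk φ α (A α ω) (x i) (x j))
      (MPS.sequentialAtTop π)
      (fun (_ : Ω) (i j : Fin m) => MPS.limitKernel φ σ (x i) (x j)) := by
  exact MPS.tendstoInMeasure_ntk _ (MPS.tendsto_sequentialAtTop π) hA φ x
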